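/- Let $f,\theta_1,\dots,\theta_s\in\mathbb R[\mathbf y]$ with $\mathbf y=(y_1,\dots,y_\ell)$, let $G(\mathbf x)$ be a $q\times q$ symmetric real polynomial matrix in $\mathbf x=(x_1,\dots,x_n)$, and let $P(\mathbf y,\mathbf x)$ be an $m\times m$ symmetric real polynomial matrix in $(\mathbf y,\mathbf x)$. Put $$\mathcal Y=\{\mathbf y\in\mathbb R^\ell\mid \theta_1(\mathbf y)\ge 0,\dots,\theta_s(\mathbf y)\ge 0\},\qquad \mathcal X=\{\mathbf x\in\mathbb R^n\mid G(\mathbf x)\succeq 0\},$$ $$f^\star=\inf\{f(\mathbf y)\mid \mathbf y\in\mathcal Y,\ P(\mathbf y,\mathbf x)\succeq 0\ \text{ for all } \mathbf x\in\mathcal X\},$$ and assume that this problem has at least one optimal solution. A polynomial $h\in\mathbb R[\mathbf y]$ is SOS-convex if its Hessian equals $T(\mathbf y)^{\intercal}T(\mathbf y)$ for some (rectangular) polynomial matrix $T$; a symmetric polynomial matrix $Q(\mathbf y)$ is PSD-SOS-convex if $\mathbf v^{\intercal}Q(\mathbf y)\mathbf v$ is SOS-convex for every real vector $\mathbf v$.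 Assume: (a) $f,-\theta_1,\dots,-\theta_s$ are SOS-convex; $-P(\mathbf y,\mathbf x)$ is PSD-SOS-convex in $\mathbf y$ for every $\mathbf x\in\mathcal X$; and $\mathcal X$ is compact; (b) (Slater condition) there is $\bar{\mathbf y}\in\mathcal Y$ with $\theta_i(\bar{\mathbf y})>0$ for $i=1,\dots,s$ and $P(\bar{\mathbf y},\mathbf x)\succ 0$ for all $\mathbf x\in\mathcal X$. For a symmetric matrix-valued measure $\Phi=(\phi_{ij})_{i,j=1}^m$ on $\mathcal X$ (each $\phi_{ij}$ a finite signed Borel measure) let $\mathscr L_\Phi(F)=\int_{\mathcal X}\operatorname{tr}(F(\mathbf x)\,d\Phi(\mathbf x))=\sum_{i,j}\int_{\mathcal X}F_{ij}\,d\phi_{ij}$ for symmetric polynomial matrices $F(\mathbf x)$ of size $m$, and, writing $P(\mathbf y,\mathbf x)=\sum_{\beta}P_\beta(\mathbf x)\mathbf y^\beta$, let $\mathscr L_\Phi(P(\mathbf y,\mathbf x))=\sum_\beta\mathscr L_\Phi(P_\beta)\,\mathbf y^\beta\in\mathbb R[\mathbf y]$. Then there is a finitely atomic PSD matrix-valued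 measure $\Phi^\star=\sum_{k=1}^r W_k\delta_{\mathbf x^{(k)}}$ on $\mathcal X$ (with $r\ge 0$, distinct points $\mathbf x^{(k)}\in\mathcal X$, and symmetric positive semidefinite matrices $W_k$) such that $$f^\star=\inf_{\mathbf y\in\mathcal Y}\bigl(f(\mathbf y)-\mathscr L_{\Phi^\star}(P(\mathbf y,\mathbf x))\bigr),$$ and, for this $\Phi^\star$, $\mathscr L_{\Phi^\star}(P(\mathbf y^\star,\mathbf x))=0$ for every optimal solution $\mathbf y^\star$ of the problem. -/

import Mathlib

open MeasureTheory MvPolynomial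
open scoped Matrix

noncomputable section

namespace RobustPMI

/-- The Hessian matrix of a real polynomial. -/
def hessian {l : ℕ} (h : MvPolynomial (Fin l) ℝ) :
    Matrix (Fin l) (Fin l) (MvPolynomial (Fin l) ℝ) :=
  Matrix.of fun i j => pderiv i (pderiv j h)

/-- `S` is an SOS matrix: `S = Tᵀ T` for a polynomial matrix `T` with `r` rows, for some `r`. -/
def IsSOSMatrix {l q : ℕ} (S : Matrix (Fin q) (Fin q) (MvPolynomial (Fin l) ℝ)) : Prop :=
  ∃ (r : ℕ) (T : Matrix (Fin r) (Fin q) (MvPolynomial (Fin l) ℝ)), S = Tᵀ * T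

/-- A polynomial is SOS-convex if its Hessian is an SOS matrix. -/
def IsSOSConvex {l : ℕ} (h : MvPolynomial (Fin l) ℝ) : Prop :=
  IsSOSMatrix (hessian h)

/-- The polynomial `vᵀ Q(y) v`, for a real vector `v`. -/
def quadForm {l m : ℕ} (Q : Matrix (Fin m) (Fin m) (MvPolynomial (Fin l) ℝ)) (v : Fin m → ℝ) :
    MvPolynomial (Fin l) ℝ :=
  (fun i => C (v i)) ⬝ᵥ (Q *ᵥ fun i => C (v i))

/-- A polynomial matrix `Q` is PSD-SOS-convex if, for every real vector `v`, the Hessian of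
`vᵀ Q(y) v` is of the form `Fᵀ F` with a polynomial matrix `F` (which may depend on `v`). -/
def IsPSDSOSConvex {l m : ℕ} (Q : Matrix (Fin m) (Fin m) (MvPolynomial (Fin l) ℝ)) : Prop :=
  ∀ v : Fin m → ℝ, IsSOSMatrix (hessian (quadForm Q v))

/-! ### Matrix-valued measures -/

/-- An `m × m` matrix-valued measure on `X ⊆ ℝⁿ`: a matrix of finite (signed) Borel measures. -/
abbrev MatrixMeasure {n : ℕ} (X : Set (Fin n → ℝ)) (m : ℕ) : Type :=
  Matrix (Fin m) (Fin m) (SignedMeasure X)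

namespace MatrixMeasure

variable {n m : ℕ} {X : Set (Fin n → ℝ)}

/-- The value `Φ(A)` of a matrix-valued measure at a set `A`. -/
def value (Φ : MatrixMeasure X m) (A : Set X) : Matrix (Fin m) (Fin m) ℝ :=
  Matrix.of fun i j => Φ i j A

/-- `Φ` is a PSD symmetric matrix-valued measure. -/
def IsPSD (Φ : MatrixMeasure X m) : Prop :=
  Φ.IsSymm ∧ ∀ A : Set X, MeasurableSet A → ∀ v : Fin m → ℝ, 0 ≤ v ⬝ᵥ (Φ.value A *ᵥ v)

/-- The matrix-valued measure `W δ_x`. -/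
def atom (x : X) (W : Matrix (Fin m) (Fin m) ℝ) : MatrixMeasure X m :=
  Matrix.of fun i j => VectorMeasure.dirac x (W i j)

/-- `Φ` is a finitely atomic PSD matrix-valued measure: `Φ = ∑ₖ Wₖ δ_{xₖ}` with finitely many
distinct points `xₖ` of `X` and positive semidefinite matrices `Wₖ`. -/
def IsFinitelyAtomicPSD (Φ : MatrixMeasure X m) : Prop :=
  Φ.IsPSD ∧ ∃ (r : ℕ) (x : Fin r → X) (W : Fin r → Matrix (Fin m) (Fin m) ℝ),
    Function.Injective x ∧ (∀ k, (W k).PosSemidef) ∧ Φ = ∑ k, atom (x k) (W k)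

/-- The tracial moment functional `L_Φ(F) = ∫ tr(F dΦ) = ∑_{i,j} ∫ F_{ij} dφ_{ij}`. -/
def functional (Φ : MatrixMeasure X m) (F : Matrix (Fin m) (Fin m) (MvPolynomial (Fin n) ℝ)) : ℝ :=
  ∑ i, ∑ j, ∫ᵛ x : X, eval (x : Fin n → ℝ) (F i j) ∂•(Φ i j)

end MatrixMeasure

/-! ### Polynomial matrices in two groups of variables `(y, x)` -/

/-- The coefficient matrix `P_β(x)` of `y ^ β` in `P(y, x)`. -/
def yCoeff {l n m : ℕ} (P : Matrix (Fin m) (Fin m) (MvPolynomial (Fin l ⊕ Fin n) ℝ))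
    (β : Fin l →₀ ℕ) : Matrix (Fin m) (Fin m) (MvPolynomial (Fin n) ℝ) :=
  P.map fun p => coeff β (sumAlgEquiv ℝ (Fin l) (Fin n) p)

/-- The finite set of exponents `β` of `y` that occur in some entry of `P(y, x)`. -/
def ySupport {l n m : ℕ} (P : Matrix (Fin m) (Fin m) (MvPolynomial (Fin l ⊕ Fin n) ℝ)) :
    Finset (Fin l →₀ ℕ) :=
  Finset.univ.biUnion fun i => Finset.univ.biUnion fun j =>
    (sumAlgEquiv ℝ (Fin l) (Fin n) (P i j)).support

/-- The polynomial `L(P(y, x)) = ∑_β L(P_β(x)) y ^ β` in `y`, for `L` acting on polynomial matrices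
in `x`. -/
def applyFunctional {l n m : ℕ} (L : Matrix (Fin m) (Fin m) (MvPolynomial (Fin n) ℝ) → ℝ)
    (P : Matrix (Fin m) (Fin m) (MvPolynomial (Fin l ⊕ Fin n) ℝ)) : MvPolynomial (Fin l) ℝ :=
  ∑ β ∈ ySupport P, monomial β (L (yCoeff P β))

/-- The polynomial matrix `P(·, x)` in `y`, for a fixed point `x ∈ ℝⁿ`. -/
def specializeX {l n m : ℕ} (P : Matrix (Fin m) (Fin m) (MvPolynomial (Fin l ⊕ Fin n) ℝ))
    (x : Fin n → ℝ) : Matrix (Fin m) (Fin m) (MvPolynomial (Fin l) ℝ) :=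
  P.map (aeval (Sum.elim MvPolynomial.X fun j => C (x j)))

/-- The real matrix `P(y, x)`, for points `y ∈ ℝˡ` and `x ∈ ℝⁿ`. -/
def evalMat {l n m : ℕ} (P : Matrix (Fin m) (Fin m) (MvPolynomial (Fin l ⊕ Fin n) ℝ))
    (y : Fin l → ℝ) (x : Fin n → ℝ) : Matrix (Fin m) (Fin m) ℝ :=
  P.map (eval (Sum.elim y x))

/-! ### The robust polynomial matrix inequality problem -/

/-- The data of the problem `inf f(y)` subject to `θ₁(y) ≥ 0, …, θₛ(y) ≥ 0` and `P(y, x) ⪰ 0` for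
all `x` with `G(x) ⪰ 0`, where `G` and `P` are symmetric polynomial matrices. -/
structure Problem (l n s q m : ℕ) where
  f : MvPolynomial (Fin l) ℝ
  θ : Fin s → MvPolynomial (Fin l) ℝ
  G : Matrix (Fin q) (Fin q) (MvPolynomial (Fin n) ℝ)
  G_symm : G.IsSymm
  P : Matrix (Fin m) (Fin m) (MvPolynomial (Fin l ⊕ Fin n) ℝ)
  P_symm : P.IsSymm

namespace Problem

variable {l n s q m : ℕ} (p : Problem l n s q m)

/-- `Y = {y | θ₁(y) ≥ 0, …, θₛ(y) ≥ 0}`. -/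
def setY : Set (Fin l → ℝ) := {y | ∀ i, 0 ≤ eval y (p.θ i)}

/-- The uncertainty set `X = {x | G(x) ⪰ 0}`. -/
def setX : Set (Fin n → ℝ) := {x | (p.G.map (eval x)).PosSemidef}

/-- The feasible set. -/
def feasible : Set (Fin l → ℝ) := {y | y ∈ p.setY ∧ ∀ x ∈ p.setX, (evalMat p.P y x).PosSemidef}

/-- The optimal value `f⋆`, as an infimum in the extended reals. -/
def optValue : EReal := ⨅ y ∈ p.feasible, ((eval y p.f : ℝ) : EReal)

/-- `y` is an optimizer. -/
def IsOptimizer (y : Fin l → ℝ) : Prop :=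
  y ∈ p.feasible ∧ ∀ z ∈ p.feasible, eval y p.f ≤ eval z p.f

/-- The SOS-convexity assumption: `f` and all `-θᵢ` are SOS-convex, `-P(y, x)` is PSD-SOS-convex
in `y` for every `x ∈ X`, and `X` is compact. -/
structure SOSConvexityAssumption : Prop where
  f_convex : IsSOSConvex p.f
  θ_concave : ∀ i, IsSOSConvex (-p.θ i)
  P_concave : ∀ x ∈ p.setX, IsPSDSOSConvex (-specializeX p.P x)
  compact : IsCompact p.setX

/-- The Slater condition. -/
def SlaterCondition : Prop :=
  ∃ y ∈ p.setY, (∀ i, 0 < eval y (p.θ i)) ∧ ∀ x ∈ p.setX, (evalMat p.P y x).PosDef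

end Problem

end RobustPMI

end

namespace RobustPMI

/-! ### Convex hulls of compact sets and a minimax alternative -/

/-! This is Lagrangian duality. Write `c` for the optimal value. The robust constraint says that the
functions `vᵀ P(y, x) v`, indexed by the compact set of `x ∈ X` and unit vectors `v`, are
nonnegative, and SOS-convexity makes each of them concave in `y`. At every `y ∈ Y` either `c - f(y)
≤ 0` or one of these functions is negative. By the minimax alternative
`exists_mem_convexHull_forall_nonpos`, a single convex combination `t (c - f) + ∑ tr (Wₖ P(·, xₖ))`
is nonpositive on all of `Y`. Slater forces `t > 0`, and division by `t` gives `c ≤ f - L_Φ(P)` on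
`Y` (`exists_multiplier`).

The functions are encoded by their finitely many coefficients in `y`, so the convex hull is compact
and its points are finite combinations: the measure is finitely atomic from the start. On feasible
points `L_Φ(P) ≥ 0`, which yields equality of values and complementary slackness. -/

/-- In a finite-dimensional space the convex hull of a compact set is compact. -/
theorem isCompact_convexHull_of_finiteDimensional {V : Type*} [NormedAddCommGroup V]
    [NormedSpace ℝ V] [FiniteDimensional ℝ V] {s : Set V} (hs : IsCompact s) :
    IsCompact (convexHull ℝ s) := by
  rcases s.eq_empty_or_nonempty with rfl | ⟨x₀, hx₀⟩
  · simp
  let N := Module.finrank ℝ V + 1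
  have hS : IsCompact (stdSimplex ℝ (Fin N) ×ˢ Set.univ.pi fun _ : Fin N => s) :=
    (isCompact_stdSimplex ℝ (Fin N)).prod (isCompact_univ_pi fun _ => hs)
  have hcont : Continuous fun a : (Fin N → ℝ) × (Fin N → V) => ∑ i, a.1 i • a.2 i := by
    fun_prop
  convert hS.image hcont using 1
  refine Set.Subset.antisymm (fun x hx => ?_) ?_
  -- Carathéodory: affine independence bounds the number of points by `N`; unused slots get weight
  -- `0` and the dummy point `x₀`.
  · obtain ⟨ι, _, z, w, hz, haff, hw, hw1, rfl⟩ := eq_pos_convex_span_of_mem_convexHull hx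
    have hcard : Fintype.card ι ≤ Fintype.card (Fin N) := by
      rw [Fintype.card_fin]
      exact haff.card_le_finrank_succ.trans
        (Nat.succ_le_succ (Submodule.finrank_le _))
    obtain ⟨e⟩ := Function.Embedding.nonempty_of_card_le hcard
    refine ⟨(Function.extend e w 0, Function.extend e z fun _ => x₀),
      ⟨⟨fun j => ?_, ?_⟩, fun j _ => ?_⟩, ?_⟩
    · by_cases hj : ∃ i, e i = j
      · obtain ⟨i, rfl⟩ := hj
        simpa only [e.injective.extend_apply] using (hw i).le
      · simp [Function.extend_apply' _ _ _ hj]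
    · rw [← hw1]
      exact (Fintype.sum_of_injective e e.injective _ _
        (fun j hj => by simp [Function.extend_apply' _ _ _ hj])
        fun i => (e.injective.extend_apply w 0 i).symm).symm
    · by_cases hj : ∃ i, e i = j
      · obtain ⟨i, rfl⟩ := hj
        simpa only [e.injective.extend_apply] using hz ⟨i, rfl⟩
      · simpa only [Function.extend_apply' _ _ _ hj] using hx₀
    · exact (Fintype.sum_of_injective e e.injective _ _
        (fun j hj => by simp [Function.extend_apply' _ _ _ hj])
        fun i => by simp only [e.injective.extend_apply]).symm
  · rintro _ ⟨⟨w, z⟩, ⟨⟨hw, hw1⟩, hz⟩, rfl⟩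
    exact (convex_convexHull ℝ s).sum_mem (fun i _ => hw i) hw1
      fun i _ => subset_convexHull ℝ s (hz i trivial)

/-- If every point `y` of a convex set admits a nonpositive member of a compact family of
concave functions, then some convex combination of the family is nonpositive everywhere. -/
theorem exists_mem_convexHull_forall_nonpos {V F : Type*} [NormedAddCommGroup V]
    [NormedSpace ℝ V] [FiniteDimensional ℝ V] [AddCommGroup F] [Module ℝ F] {K : Set V}
    (hK : IsCompact K) (hne : K.Nonempty) {Y : Set F} (e : F → V →L[ℝ] ℝ)
    (hconc : ∀ g ∈ K, ConcaveOn ℝ Y fun y => e y g) (h : ∀ y ∈ Y, ∃ g ∈ K, e y g ≤ 0) :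
    ∃ d ∈ convexHull ℝ K, ∀ y ∈ Y, e y d ≤ 0 := by
  classical
  have hD := isCompact_convexHull_of_finiteDimensional hK
  suffices (convexHull ℝ K ∩ ⋂ y : Y, {d | e y d ≤ 0}).Nonempty by
    obtain ⟨d, hd, hd'⟩ := this
    exact ⟨d, hd, fun y hy => Set.mem_iInter.1 hd' ⟨y, hy⟩⟩
  -- By compactness of the hull, finitely many `y` at a time suffice.
  refine hD.inter_iInter_nonempty _
    (fun y => isClosed_le (e y).continuous continuous_const) fun u => ?_
  by_contra hemp
  let A : V →L[ℝ] (u → ℝ) := ContinuousLinearMap.pi fun y : u => e y.1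
  have hdisj : Disjoint (A '' convexHull ℝ K) (Set.Iic 0) := by
    rw [Set.disjoint_left]
    rintro _ ⟨d, hd, rfl⟩ hle
    refine hemp ⟨d, hd, Set.mem_iInter₂.2 fun y hy => ?_⟩
    exact hle ⟨y, hy⟩
  -- If these `y` have no common `d`, the vectors of values over the hull miss the nonpositive
  -- orthant and can be strictly separated from it.
  obtain ⟨φ, a, b, ha, hab, hb⟩ := geometric_hahn_banach_compact_closed
    ((convex_convexHull ℝ K).linear_image A.toLinearMap) (hD.image A.continuous)
    (convex_Iic (0 : u → ℝ)) isClosed_Iic hdisj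
  have hb0 : b < 0 := by simpa using hb 0 (Set.mem_Iic.2 le_rfl)
  let w : u → ℝ := fun y => -φ (Pi.single y 1)
  have hw : ∀ y, 0 ≤ w y := by
    intro y
    by_contra hlt
    have hpos : 0 < φ (Pi.single y 1) := by simpa [w] using hlt
    -- This point of the orthant has `φ`-value exactly `b`, against the strict bound `hb`.
    have hmem : (b / φ (Pi.single y 1)) • (Pi.single y 1 : u → ℝ) ∈ Set.Iic 0 := by
      have : b / φ (Pi.single y 1) ≤ 0 := div_nonpos_of_nonpos_of_nonneg hb0.le hpos.le
      intro j
      rw [Pi.smul_apply, smul_eq_mul]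
      refine mul_nonpos_of_nonpos_of_nonneg this ?_
      rw [Pi.single_apply]
      split_ifs <;> norm_num
    have := hb _ hmem
    rw [map_smul, smul_eq_mul, div_mul_cancel₀ _ hpos.ne'] at this
    exact lt_irrefl _ this
  have hφ : ∀ z : u → ℝ, φ z = -∑ y, w y * z y := by
    intro z
    conv_lhs => rw [pi_eq_sum_univ' z]
    simp [w, map_sum, mul_comm]
  have hpos : ∀ d ∈ convexHull ℝ K, 0 < ∑ y : u, w y * e y.1 d := by
    intro d hd
    have h1 := ha _ ⟨d, hd, rfl⟩
    rw [hφ] at h1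
    have : ∑ y : u, w y * A d y = ∑ y : u, w y * e y.1 d := rfl
    change -∑ y : u, w y * A d y < a at h1
    linarith
  have hwsum : 0 < ∑ y, w y := by
    refine (Finset.sum_nonneg fun y _ => hw y).lt_of_ne' fun h0 => ?_
    have hz := (Finset.sum_eq_zero_iff_of_nonneg fun y _ => hw y).1 h0
    obtain ⟨g, hg⟩ := hne
    have := hpos g (subset_convexHull ℝ K hg)
    rw [Finset.sum_eq_zero fun y hy => by rw [hz y hy, zero_mul]] at this
    exact lt_irrefl _ this
  have hYconv : Convex ℝ Y := (hconc _ hne.some_mem).1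
  -- At the barycentre of the `y`'s some `g` is nonpositive, while Jensen bounds its value below by
  -- a positive average.
  obtain ⟨g, hg, hle⟩ := h (Finset.univ.centerMass w fun y : u => (y.1 : F))
    (hYconv.centerMass_mem (fun y _ => hw y) hwsum fun y _ => y.1.2)
  have hjen := (hconc g hg).le_map_centerMass (t := Finset.univ) (w := w)
    (p := fun y : u => (y.1 : F)) (fun y _ => hw y) hwsum fun y _ => y.1.2
  have : 0 < Finset.univ.centerMass w ((fun y => e y g) ∘ fun y : u => (y.1 : F)) := by
    rw [Finset.centerMass]
    exact mul_pos (inv_pos.2 hwsum) (hpos g (subset_convexHull ℝ K hg))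
  linarith

/-! ### SOS-convex polynomials are convex -/

theorem hasDerivAt_eval_line {l : ℕ} (h : MvPolynomial (Fin l) ℝ) (y u : Fin l → ℝ) (t : ℝ) :
    HasDerivAt (fun t : ℝ => eval (y + t • u) h)
      (∑ i, u i * eval (y + t • u) (pderiv i h)) t := by
  induction h using MvPolynomial.induction_on with
  | C a => simpa using hasDerivAt_const t a
  | add p q hp hq =>
    simp only [map_add, mul_add, Finset.sum_add_distrib]
    exact hp.add hq
  | mul_X p j hp =>
    have hX : HasDerivAt (fun t : ℝ => (y + t • u) j) (u j) t := by
      simpa using ((hasDerivAt_id t).mul_const (u j)).const_add (y j)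
    have := hp.mul hX
    simp only [map_mul, eval_X]
    refine this.congr_deriv ?_
    simp only [Derivation.leibniz, pderiv_X, smul_eq_mul, map_add, map_mul, eval_X, mul_add,
      Finset.sum_add_distrib, Finset.sum_mul]
    rw [add_comm]
    congr 1
    · simp [Pi.single_apply, Finset.sum_ite_eq, apply_ite (eval (y + t • u)), mul_comm]
    · exact Finset.sum_congr rfl fun i _ => by ring

/-- The form is `‖T u‖²`. The index order `S j i` matches the second derivative along a line given
by `hasDerivAt_eval_line` used twice. -/
theorem IsSOSMatrix.eval_nonneg {l q : ℕ} {S : Matrix (Fin q) (Fin q) (MvPolynomial (Fin l) ℝ)}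
    (hS : IsSOSMatrix S) (y : Fin l → ℝ) (u : Fin q → ℝ) :
    0 ≤ ∑ i, u i * ∑ j, u j * eval y (S j i) := by
  obtain ⟨r, T, rfl⟩ := hS
  have : ∑ i, u i * ∑ j, u j * eval y ((Tᵀ * T) j i)
      = ∑ k, (∑ i, u i * eval y (T k i)) ^ 2 := by
    simp only [Matrix.mul_apply, Matrix.transpose_apply, map_sum, map_mul, sq,
      Finset.sum_mul_sum]
    simp only [Finset.mul_sum]
    rw [Finset.sum_congr rfl fun i _ => Finset.sum_comm, Finset.sum_comm]
    exact Finset.sum_congr rfl fun k _ => Finset.sum_congr rfl fun i _ =>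
      Finset.sum_congr rfl fun j _ => by ring
  rw [this]
  exact Finset.sum_nonneg fun k _ => sq_nonneg _

theorem IsSOSConvex.convexOn {l : ℕ} {h : MvPolynomial (Fin l) ℝ} (hh : IsSOSConvex h) :
    ConvexOn ℝ Set.univ fun y => eval y h := by
  refine ⟨convex_univ, fun y _ z _ a b ha hb hab => ?_⟩
  have hline : ConvexOn ℝ Set.univ fun t : ℝ => eval (y + t • (z - y)) h := by
    refine convexOn_of_hasDerivWithinAt2_nonneg convex_univ
      (fun t _ => (hasDerivAt_eval_line h y (z - y) t).continuousAt.continuousWithinAt)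
      (fun t _ => (hasDerivAt_eval_line h y (z - y) t).hasDerivWithinAt)
      (fun t _ => (HasDerivAt.fun_sum fun i _ =>
        (hasDerivAt_eval_line (pderiv i h) y (z - y) t).const_mul
          ((z - y) i)).hasDerivWithinAt)
      fun t _ => ?_
    exact hh.eval_nonneg (y + t • (z - y)) (z - y)
  have := hline.2 (Set.mem_univ 0) (Set.mem_univ 1) ha hb hab
  simp only [smul_eq_mul, mul_zero, mul_one, zero_add, zero_smul, add_zero, one_smul,
    add_sub_cancel] at this
  have hpt : a • y + b • z = y + b • (z - y) := by
    obtain rfl : a = 1 - b := by linarith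
    module
  simpa only [hpt, smul_eq_mul] using this

end RobustPMI

namespace RobustPMI

/-! ### Evaluation of polynomial matrices in two groups of variables -/

theorem eval_specializeX {l n m : ℕ} (P : Matrix (Fin m) (Fin m) (MvPolynomial (Fin l ⊕ Fin n) ℝ))
    (y : Fin l → ℝ) (x : Fin n → ℝ) (i j : Fin m) :
    eval y (specializeX P x i j) = evalMat P y x i j := by
  simp only [specializeX, evalMat, Matrix.map_apply]
  induction P i j using MvPolynomial.induction_on with
  | C a => simp
  | add p q hp hq => simp only [map_add, hp, hq]
  | mul_X p k hp => rcases k with k | k <;> simp only [map_mul, hp] <;> simp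

theorem eval_quadForm {l m : ℕ} (Q : Matrix (Fin m) (Fin m) (MvPolynomial (Fin l) ℝ))
    (v : Fin m → ℝ) (y : Fin l → ℝ) :
    eval y (quadForm Q v) = v ⬝ᵥ (Q.map (eval y) *ᵥ v) := by
  simp [quadForm, dotProduct, Matrix.mulVec, map_sum]

theorem concaveOn_dotProduct_evalMat {l n m : ℕ}
    {P : Matrix (Fin m) (Fin m) (MvPolynomial (Fin l ⊕ Fin n) ℝ)} {x : Fin n → ℝ}
    (hP : IsPSDSOSConvex (-specializeX P x)) (v : Fin m → ℝ) :
    ConcaveOn ℝ Set.univ fun y => v ⬝ᵥ (evalMat P y x *ᵥ v) := by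
  have h := (IsSOSConvex.convexOn (hP v)).neg
  refine h.congr fun y _ => ?_
  have : (-specializeX P x).map (eval y) = -evalMat P y x := by
    ext i j
    simp [eval_specializeX]
  simp [eval_quadForm, this, Matrix.neg_mulVec]

theorem eval₂_sumAlgEquiv {l n : ℕ} (p : MvPolynomial (Fin l ⊕ Fin n) ℝ)
    (y : Fin l → ℝ) (x : Fin n → ℝ) :
    eval₂ (eval x) y (sumAlgEquiv ℝ (Fin l) (Fin n) p) = eval (Sum.elim y x) p := by
  induction p using MvPolynomial.induction_on with
  | C a => simp [sumAlgEquiv_C_inl]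
  | add p q hp hq => simp only [map_add, eval₂_add, hp, hq]
  | mul_X p k hp => rcases k with k | k <;> simp [hp]

theorem sum_yCoeff_mul_prod {l n m : ℕ}
    (P : Matrix (Fin m) (Fin m) (MvPolynomial (Fin l ⊕ Fin n) ℝ))
    (y : Fin l → ℝ) (x : Fin n → ℝ) (i j : Fin m) :
    ∑ β ∈ ySupport P, eval x (yCoeff P β i j) * β.prod (fun i k => y i ^ k)
      = evalMat P y x i j := by
  rw [evalMat, Matrix.map_apply, ← eval₂_sumAlgEquiv, eval₂_eq]
  simp only [yCoeff, Matrix.map_apply]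
  symm
  -- `ySupport` is shared by all entries; exponents absent from this entry contribute zero.
  refine Finset.sum_subset_zero_on_sdiff (fun β hβ => ?_) (fun β hβ => ?_) fun β _ => rfl
  · exact Finset.mem_biUnion.2 ⟨i, Finset.mem_univ _,
      Finset.mem_biUnion.2 ⟨j, Finset.mem_univ _, hβ⟩⟩
  · rw [notMem_support_iff.1 (Finset.mem_sdiff.1 hβ).2]
    simp

/-- The pairing of a quadratic form `v vᵀ` with a matrix. -/
theorem sum_vecMulVec_mul {m : ℕ} (M : Matrix (Fin m) (Fin m) ℝ) (v : Fin m → ℝ) :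
    ∑ i, ∑ j, Matrix.vecMulVec v v i j * M i j = v ⬝ᵥ (M *ᵥ v) := by
  simp only [dotProduct, Matrix.mulVec, Matrix.vecMulVec_apply, Finset.mul_sum]
  exact Finset.sum_congr rfl fun i _ => Finset.sum_congr rfl fun j _ => by ring

/-- Schur product theorem: the sum is `1ᵀ (A ∘ B) 1`, with `∘` the entrywise product. -/
theorem _root_.Matrix.PosSemidef.sum_mul_nonneg {m : ℕ} {A B : Matrix (Fin m) (Fin m) ℝ}
    (hA : A.PosSemidef) (hB : B.PosSemidef) : 0 ≤ ∑ i, ∑ j, A i j * B i j := by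
  simpa [dotProduct, Matrix.mulVec] using (hA.hadamard hB).dotProduct_mulVec_nonneg 1

/-! ### Finitely atomic matrix-valued measures -/

namespace MatrixMeasure

variable {n m : ℕ} {X : Set (Fin n → ℝ)}

theorem functional_sum_atom {r : ℕ} (x : Fin r → X) (W : Fin r → Matrix (Fin m) (Fin m) ℝ)
    (F : Matrix (Fin m) (Fin m) (MvPolynomial (Fin n) ℝ)) :
    (∑ k, atom (x k) (W k)).functional F
      = ∑ k, ∑ i, ∑ j, W k i j * eval (x k : Fin n → ℝ) (F i j) := by
  have hint : ∀ i j k, ((VectorMeasure.dirac (x k) (W k i j) : SignedMeasure X)).Integrable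
      fun z : X => eval (z : Fin n → ℝ) (F i j) := by
    intro i j k
    rw [VectorMeasure.Integrable, VectorMeasure.variation_dirac]
    refine Integrable.smul_measure ?_ (by simp)
    exact integrable_dirac (by simp)
  have hij : ∀ i j, ∫ᵛ z : X, eval (z : Fin n → ℝ) (F i j) ∂•((∑ k, atom (x k) (W k)) i j)
      = ∑ k, W k i j * eval (x k : Fin n → ℝ) (F i j) := by
    intro i j
    rw [Matrix.sum_apply]
    simp only [atom, Matrix.of_apply]
    rw [VectorMeasure.integral_finsetSum_vectorMeasure fun k _ => hint i j k]
    refine Finset.sum_congr rfl fun k _ => ?_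
    rw [VectorMeasure.integral_dirac]
    simp [mul_comm]
  simp only [functional, hij]
  rw [Finset.sum_congr rfl fun i _ => Finset.sum_comm, Finset.sum_comm]

theorem isPSD_sum_atom {r : ℕ} (x : Fin r → X) (W : Fin r → Matrix (Fin m) (Fin m) ℝ)
    (hW : ∀ k, (W k).PosSemidef) : (∑ k, atom (x k) (W k)).IsPSD := by
  classical
  refine ⟨?_, fun A hA v => ?_⟩
  · refine Matrix.IsSymm.ext fun i j => ?_
    simp only [Matrix.sum_apply, atom, Matrix.of_apply]
    refine Finset.sum_congr rfl fun k _ => ?_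
    rw [show W k j i = W k i j by simpa using (hW k).isHermitian.apply i j]
  · have : value (∑ k, atom (x k) (W k)) A = ∑ k, if x k ∈ A then W k else 0 := by
      ext i j
      simp only [value, Matrix.of_apply, Matrix.sum_apply, atom, FunLike.coe_sum,
        Finset.sum_apply]
      refine Finset.sum_congr rfl fun k _ => ?_
      split_ifs with h
      · exact VectorMeasure.dirac_apply_of_mem hA h
      · exact VectorMeasure.dirac_apply_of_notMem h
    rw [this]
    have hpsd : (∑ k, if x k ∈ A then W k else 0).PosSemidef := by
      refine Matrix.posSemidef_sum _ fun k _ => ?_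
      split_ifs
      · exact hW k
      · exact Matrix.PosSemidef.zero
    simpa using hpsd.dotProduct_mulVec_nonneg v

/-- The finitely atomic measure attached to a finitely supported family of matrices. -/
theorem exists_isFinitelyAtomicPSD (w : X →₀ Matrix (Fin m) (Fin m) ℝ)
    (hw : ∀ x, (w x).PosSemidef) :
    ∃ Φ : MatrixMeasure X m, Φ.IsFinitelyAtomicPSD ∧ ∀ F : Matrix (Fin m) (Fin m) _,
      Φ.functional F = w.sum fun x W => ∑ i, ∑ j, W i j * eval (x : Fin n → ℝ) (F i j) := by
  let e := w.support.equivFin.symm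
  refine ⟨∑ k, atom (e k : X) (w (e k)), ⟨isPSD_sum_atom _ _ fun k => hw _, _, fun k => (e k : X),
    fun k => w (e k), Subtype.val_injective.comp e.injective, fun k => hw _, rfl⟩, fun F => ?_⟩
  rw [functional_sum_atom, Finsupp.sum, ← Finset.sum_coe_sort w.support]
  exact Equiv.sum_comp e fun x : w.support =>
    ∑ i, ∑ j, w x i j * eval ((x : X) : Fin n → ℝ) (F i j)

end MatrixMeasure

/-- Turns the multiplier inequality for `w` into one about the measure, by exchanging the sums over
exponents and atoms. -/
theorem eval_applyFunctional {l n m : ℕ} {X : Set (Fin n → ℝ)}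
    (P : Matrix (Fin m) (Fin m) (MvPolynomial (Fin l ⊕ Fin n) ℝ))
    {L : Matrix (Fin m) (Fin m) (MvPolynomial (Fin n) ℝ) → ℝ}
    {w : X →₀ Matrix (Fin m) (Fin m) ℝ}
    (hL : ∀ F, L F = w.sum fun x W => ∑ i, ∑ j, W i j * eval (x : Fin n → ℝ) (F i j))
    (y : Fin l → ℝ) :
    eval y (applyFunctional L P)
      = w.sum fun x W => ∑ i, ∑ j, W i j * evalMat P y x i j := by
  simp only [applyFunctional, map_sum, eval_monomial, hL, Finsupp.sum,
    ← sum_yCoeff_mul_prod, Finset.mul_sum]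
  rw [Finset.sum_comm]
  refine Finset.sum_congr rfl fun x _ => ?_
  rw [Finset.sum_comm]
  refine Finset.sum_congr rfl fun i _ => ?_
  rw [Finset.sum_comm]
  exact Finset.sum_congr rfl fun j _ => Finset.sum_congr rfl fun β _ => by
    rw [mul_assoc]

end RobustPMI

namespace RobustPMI

/-! ### Lagrange multipliers -/

section Moments

variable {l n m : ℕ} (P : Matrix (Fin m) (Fin m) (MvPolynomial (Fin l ⊕ Fin n) ℝ))

/-- The coefficient vector of the polynomial `tr (W P(y, x))` in `y`. -/
noncomputable def momentMap (x : Fin n → ℝ) : Matrix (Fin m) (Fin m) ℝ →ₗ[ℝ] (ySupport P → ℝ) where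
  toFun W β := ∑ i, ∑ j, W i j * eval x (yCoeff P β i j)
  map_add' W W' := by
    ext β
    simp [add_mul, Finset.sum_add_distrib]
  map_smul' c W := by
    ext β
    simp [mul_assoc, Finset.mul_sum]

/-- Evaluation at `y` of a polynomial given by its coefficient vector. -/
noncomputable def coeffEval (y : Fin l → ℝ) : (ySupport P → ℝ) →L[ℝ] ℝ :=
  ∑ β : ySupport P, (β.1.prod fun i k => y i ^ k) • ContinuousLinearMap.proj β

theorem coeffEval_momentMap (y : Fin l → ℝ) (x : Fin n → ℝ) (W : Matrix (Fin m) (Fin m) ℝ) :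
    coeffEval P y (momentMap P x W) = ∑ i, ∑ j, W i j * evalMat P y x i j := by
  simp only [coeffEval, momentMap, LinearMap.coe_mk, AddHom.coe_mk,
    _root_.sum_apply, _root_.smul_apply,
    ContinuousLinearMap.proj_apply, smul_eq_mul, ← sum_yCoeff_mul_prod, Finset.mul_sum]
  rw [Finset.sum_coe_sort (ySupport P) fun β => ∑ i, ∑ j,
    (β.prod fun i k => y i ^ k) * (W i j * eval x (yCoeff P β i j)), Finset.sum_comm]
  refine Finset.sum_congr rfl fun i _ => ?_
  rw [Finset.sum_comm]
  exact Finset.sum_congr rfl fun j _ => Finset.sum_congr rfl fun β _ => by ring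

theorem continuous_momentMap_vecMulVec :
    Continuous fun a : (Fin n → ℝ) × (Fin m → ℝ) =>
      momentMap P a.1 (Matrix.vecMulVec a.2 a.2) := by
  refine continuous_pi fun β => ?_
  change Continuous fun a : (Fin n → ℝ) × (Fin m → ℝ) =>
    ∑ i, ∑ j, Matrix.vecMulVec a.2 a.2 i j * eval a.1 (yCoeff P β i j)
  refine continuous_finsetSum _ fun i _ =>
    continuous_finsetSum _ fun j _ => ?_
  simp only [Matrix.vecMulVec_apply]
  have h := (MvPolynomial.continuous_eval (yCoeff P β i j)).comp
    (continuous_fst : Continuous fun a : (Fin n → ℝ) × (Fin m → ℝ) => a.1)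
  exact (by fun_prop : Continuous fun a : (Fin n → ℝ) × (Fin m → ℝ) => a.2 i * a.2 j).mul h

end Moments

namespace Problem

variable {l n s q m : ℕ} (p : Problem l n s q m)

theorem convex_setY (hθ : ∀ i, IsSOSConvex (-p.θ i)) : Convex ℝ p.setY := by
  have : p.setY = ⋂ i, {y | eval y (-p.θ i) ≤ 0} := by
    ext y
    simp [setY]
  rw [this]
  refine convex_iInter fun i => ?_
  simpa using (hθ i).convexOn.convex_le 0

theorem isHermitian_evalMat (y : Fin l → ℝ) (x : Fin n → ℝ) : (evalMat p.P y x).IsHermitian := by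
  refine Matrix.IsHermitian.ext fun i j => ?_
  simp [evalMat, p.P_symm.apply i j]

/-- A point of `Y` violating the matrix inequality is cut off by a vector of norm one. -/
theorem exists_dotProduct_neg_of_notMem_feasible {y : Fin l → ℝ} (hy : y ∈ p.setY)
    (hn : y ∉ p.feasible) :
    ∃ x ∈ p.setX, ∃ v ∈ Metric.sphere (0 : Fin m → ℝ) 1, v ⬝ᵥ (evalMat p.P y x *ᵥ v) < 0 := by
  have : ∃ x ∈ p.setX, ¬(evalMat p.P y x).PosSemidef := by
    by_contra! h
    exact hn ⟨hy, h⟩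
  obtain ⟨x, hx, hnp⟩ := this
  rw [Matrix.posSemidef_iff_dotProduct_mulVec] at hnp
  push Not at hnp
  obtain ⟨v, hv⟩ := hnp (p.isHermitian_evalMat y x)
  have hv' : v ⬝ᵥ (evalMat p.P y x *ᵥ v) < 0 := by simpa using hv
  have hv0 : v ≠ 0 := by
    rintro rfl
    simp at hv'
  have hnorm : 0 < ‖v‖ := norm_pos_iff.2 hv0
  -- The norm is the sup norm; all that matters is that its unit sphere is compact and avoids `0`.
  refine ⟨x, hx, ‖v‖⁻¹ • v, ?_, ?_⟩
  · simp [norm_smul, hnorm.ne']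
  · rw [Matrix.mulVec_smul, dotProduct_smul, smul_dotProduct]
    exact smul_neg_of_pos_of_neg (inv_pos.2 hnorm)
      (smul_neg_of_pos_of_neg (inv_pos.2 hnorm) hv')

theorem exists_multiplier (hconv : p.SOSConvexityAssumption) (hslater : p.SlaterCondition)
    {c : ℝ} (hc : ∀ y ∈ p.feasible, c ≤ eval y p.f) :
    ∃ w : p.setX →₀ Matrix (Fin m) (Fin m) ℝ, (∀ x, (w x).PosSemidef) ∧
      ∀ y ∈ p.setY, c ≤ eval y p.f -
        w.sum fun x W => ∑ i, ∑ j, W i j * evalMat p.P y x i j := by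
  let gen : (Fin n → ℝ) × (Fin m → ℝ) → (ySupport p.P → ℝ) × ℝ :=
    fun a => (momentMap p.P a.1 (Matrix.vecMulVec a.2 a.2), 0)
  let T : Set ((Fin n → ℝ) × (Fin m → ℝ)) := p.setX ×ˢ Metric.sphere 0 1
  -- The last coordinate carries the weight of `c - f`, so `(0, 1)` encodes `c - f` itself; it also
  -- keeps `K` nonempty when `X` is empty.
  let K : Set ((ySupport p.P → ℝ) × ℝ) := insert (0, 1) (gen '' T)
  have hK : IsCompact K := by
    refine IsCompact.insert ((hconv.compact.prod (isCompact_sphere 0 1)).image ?_) _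
    exact (continuous_momentMap_vecMulVec p.P).prodMk continuous_const
  let e : (Fin l → ℝ) → ((ySupport p.P → ℝ) × ℝ) →L[ℝ] ℝ := fun y =>
    (coeffEval p.P y).comp (ContinuousLinearMap.fst ℝ _ _)
      + (c - eval y p.f) • ContinuousLinearMap.snd ℝ _ _
  have he : ∀ y d, e y d = coeffEval p.P y d.1 + (c - eval y p.f) * d.2 := fun y d => rfl
  have hgen : ∀ y a, e y (gen a) = a.2 ⬝ᵥ (evalMat p.P y a.1 *ᵥ a.2) := fun y a => by
    simp [he, gen, coeffEval_momentMap, sum_vecMulVec_mul]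
  have hY := p.convex_setY hconv.θ_concave
  have hconc : ∀ g ∈ K, ConcaveOn ℝ p.setY fun y => e y g := by
    rintro g (rfl | ⟨a, ha, rfl⟩)
    · have h := (hconv.f_convex.convexOn.subset (Set.subset_univ _) hY).neg.add_const c
      refine h.congr fun y _ => ?_
      simp [he, sub_eq_neg_add]
    · simp only [hgen]
      exact (concaveOn_dotProduct_evalMat (hconv.P_concave a.1 ha.1) a.2).subset
        (Set.subset_univ _) hY
  obtain ⟨d, hd, hdY⟩ := exists_mem_convexHull_forall_nonpos hK (Set.insert_nonempty _ _) e hconc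
    fun y hy => by
      by_cases hf : y ∈ p.feasible
      · exact ⟨_, Set.mem_insert _ _, by simpa [he] using hc y hf⟩
      · obtain ⟨x, hx, v, hv, hneg⟩ := p.exists_dotProduct_neg_of_notMem_feasible hy hf
        exact ⟨gen (x, v), Set.mem_insert_of_mem _ ⟨(x, v), ⟨hx, hv⟩, rfl⟩,
          (hgen y (x, v)).trans_le hneg.le⟩
  -- The PSD families with a nonnegative scalar form a convex set whose image under `Λ` contains
  -- `K`, hence its hull. Indexing by points of `X` merges repeated atoms.
  let Λ : ((p.setX →₀ Matrix (Fin m) (Fin m) ℝ) × ℝ) →ₗ[ℝ] (ySupport p.P → ℝ) × ℝ :=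
    (Finsupp.lsum ℝ fun x : p.setX => momentMap p.P x).prodMap LinearMap.id
  let S : Set ((p.setX →₀ Matrix (Fin m) (Fin m) ℝ) × ℝ) :=
    {a | (∀ x, (a.1 x).PosSemidef) ∧ 0 ≤ a.2}
  have hS : Convex ℝ S := fun a ha b hb α β hα hβ _ =>
    ⟨fun x => ((ha.1 x).smul hα).add ((hb.1 x).smul hβ),
      add_nonneg (mul_nonneg hα ha.2) (mul_nonneg hβ hb.2)⟩
  have hKS : convexHull ℝ K ⊆ Λ '' S := by
    refine convexHull_min ?_ (hS.linear_image Λ)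
    rintro g (rfl | ⟨⟨x, v⟩, ⟨hx, hv⟩, rfl⟩)
    · exact ⟨(0, 1), ⟨fun x => Matrix.PosSemidef.zero, zero_le_one⟩, by simp [Λ]⟩
    · refine ⟨(Finsupp.single ⟨x, hx⟩ (Matrix.vecMulVec v v), 0), ⟨fun z => ?_, le_rfl⟩, ?_⟩
      · classical
        rw [Finsupp.single_apply]
        split_ifs
        · simpa using Matrix.posSemidef_vecMulVec_self_star v
        · exact Matrix.PosSemidef.zero
      · simp [Λ, gen]
  obtain ⟨⟨w, t⟩, ⟨hw, ht⟩, rfl⟩ := hKS hd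
  have hΛ : ∀ y, e y (Λ (w, t)) =
      (w.sum fun x W => ∑ i, ∑ j, W i j * evalMat p.P y x i j) + (c - eval y p.f) * t := by
    intro y
    simp [he, Λ, Finsupp.sum, map_sum, coeffEval_momentMap]
  have htpos : 0 < t := by
    obtain ⟨y₀, hy₀, -, hpos⟩ := hslater
    refine ht.lt_of_ne' fun h0 => ?_
    have hlin : IsLinearMap ℝ fun g : (ySupport p.P → ℝ) × ℝ => coeffEval p.P y₀ g.1 + g.2 :=
      ((coeffEval p.P y₀).toLinearMap.comp (LinearMap.fst ℝ _ _)
        + LinearMap.snd ℝ _ _).isLinear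
    -- At the Slater point this functional is positive on every generator, so on the hull; with `t =
    -- 0` it would equal `e y₀ d ≤ 0`.
    have hsub : convexHull ℝ K ⊆ {g | 0 < coeffEval p.P y₀ g.1 + g.2} := by
      refine convexHull_min ?_ (convex_halfSpace_gt hlin 0)
      rintro g (rfl | ⟨⟨x, v⟩, ⟨hx, hv⟩, rfl⟩)
      · simp
      · have hv0 : v ≠ 0 := by
          rintro rfl
          simp at hv
        simpa [gen, coeffEval_momentMap, sum_vecMulVec_mul] using
          (hpos x hx).dotProduct_mulVec_pos hv0
    have h1 : 0 < coeffEval p.P y₀ (Λ (w, t)).1 + (Λ (w, t)).2 := hsub hd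
    have h2 := hdY y₀ hy₀
    rw [he] at h2
    have h3 : (Λ (w, t)).2 = 0 := h0
    rw [h3] at h1 h2
    linarith
  refine ⟨t⁻¹ • w, fun x => (hw x).smul (inv_nonneg.2 ht), fun y hy => ?_⟩
  have h1 := hdY y hy
  rw [hΛ] at h1
  have h2 : ((t⁻¹ • w).sum fun x W => ∑ i, ∑ j, W i j * evalMat p.P y x i j)
      = t⁻¹ * w.sum fun x W => ∑ i, ∑ j, W i j * evalMat p.P y x i j := by
    rw [Finsupp.sum_smul_index' (by simp), Finsupp.sum, Finsupp.sum, Finset.mul_sum]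
    simp [Finset.mul_sum, mul_assoc]
  rw [h2]
  have h3 : t⁻¹ * (w.sum fun x W => ∑ i, ∑ j, W i j * evalMat p.P y x i j)
      ≤ t⁻¹ * ((eval y p.f - c) * t) :=
    mul_le_mul_of_nonneg_left (by linarith) (inv_nonneg.2 ht)
  have h4 : t⁻¹ * ((eval y p.f - c) * t) = eval y p.f - c := by field_simp
  linarith

end Problem

end RobustPMI

open RobustPMI in
theorem mainTheorem3 {l n s q m : ℕ} (p : Problem l n s q m)
    (hopt : ∃ y, p.IsOptimizer y)
    (hconv : p.SOSConvexityAssumption)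
    (hslater : p.SlaterCondition) :
    ∃ Φ : MatrixMeasure p.setX m, Φ.IsFinitelyAtomicPSD ∧
      p.optValue = (⨅ y ∈ p.setY,
        ((eval y p.f - eval y (applyFunctional Φ.functional p.P) : ℝ) : EReal)) ∧
      ∀ y, p.IsOptimizer y → eval y (applyFunctional Φ.functional p.P) = 0 := by
  obtain ⟨y₀, hy₀⟩ := hopt
  obtain ⟨w, hw, hmul⟩ := p.exists_multiplier hconv hslater hy₀.2
  obtain ⟨Φ, hΦ, hfun⟩ := MatrixMeasure.exists_isFinitelyAtomicPSD w hw
  have heval := eval_applyFunctional p.P hfun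
  have hnonneg : ∀ y ∈ p.feasible, 0 ≤ eval y (applyFunctional Φ.functional p.P) := by
    intro y hy
    rw [heval]
    exact Finset.sum_nonneg fun x _ => (hw x).sum_mul_nonneg (hy.2 x x.2)
  simp only [← heval] at hmul
  -- With `L = L_Φ(P)`, optimality gives `f(y) ≤ f(y₀) ≤ f(y) - L(y)`, and `L(y) ≥ 0` by
  -- feasibility.
  have hslack : ∀ y, p.IsOptimizer y → eval y (applyFunctional Φ.functional p.P) = 0 := by
    intro y hy
    have h1 := hmul y hy.1.1
    have h2 := hy.2 y₀ hy₀.1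
    have h3 := hnonneg y hy.1
    linarith
  refine ⟨Φ, hΦ, ?_, hslack⟩
  have hval : p.optValue = ((eval y₀ p.f : ℝ) : EReal) :=
    le_antisymm (iInf₂_le y₀ hy₀.1) (le_iInf₂ fun y hy => EReal.coe_le_coe_iff.2 (hy₀.2 y hy))
  rw [hval]
  refine le_antisymm (le_iInf₂ fun y hy => EReal.coe_le_coe_iff.2 (hmul y hy)) ?_
  refine (iInf₂_le y₀ hy₀.1.1).trans_eq ?_
  rw [hslack y₀ hy₀, sub_zero]
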